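/- Let $n,m\ge 1$ be integers, $\mu>0$, $\alpha>-1$ and $1\le p<\infty$. Write $\|\cdot\|$ for the standard Hermitian norm, let $$D_{n,m}(\mu)=\{(z,w)\in\mathbb{C}^n\times\mathbb{C}^m:\ \|w\|^2<e^{-\mu\|z\|^2}\},\qquad \rho(z,w)=\|w\|^2-e^{-\mu\|z\|^2},$$ and let $dV$ be Lebesgue measure. For a continuous positive weight $\eta$ on $D=D_{n,m}(\mu)$ let $L^p(D,\eta)$ be the space of measurable $f:D\to\mathbb{C}$ with $\|f\|_{p,\eta}=\big(\int_D|f|^p\,\eta\,dV\big)^{1/p}<\infty$ (functions equal almost everywhere being identified), let $A^2(D,\eta)$ be the closed subspace of the Hilbert space $L^2(D,\eta)$ consisting of the holomorphic functions, and let the weighted Bergman projection $P_{D,\eta}:L^2(D,\eta)\to A^2(D,\eta)$ be the orthogonal projection. Say that $P_{D,\eta}$ is bounded on $L^p(D,\eta)$ if there is a constant $C<\infty$ such that $P_{D,\eta}f\in L^p(D,\eta)$ and $\|P_{D,\eta}f\|_{p,\eta}\le C\|f\|_{p,\eta}$ for every $f\in L^p(D,\eta)\cap L^2(D,\eta)$.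 Then $P_{D,(-\rho)^\alpha}$ is bounded on $L^p(D,(-\rho)^\alpha)$ if and only if $p=2$. In particular (the case $\alpha=0$), the ordinary Bergman projection $P_{D,1}$ of $D_{n,m}(\mu)$ is bounded on $L^p(D)$ if and only if $p=2$. -/

import Mathlib

namespace FockBargmannHartogs

section General

open MeasureTheory Metric Set Filter Topology
open scoped ENNReal NNReal

/-- A locally uniform limit of holomorphic functions on an open set is holomorphic. -/
theorem exists_differentiableOn_limit {E : Type*} [NormedAddCommGroup E]
    [NormedSpace ℂ E] {Ω : Set E} (hΩ : IsOpen Ω) {u : ℕ → E → ℂ}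
    (hu : ∀ k, DifferentiableOn ℂ (u k) Ω)
    (hc : ∀ x ∈ Ω, ∃ r > 0, ball x r ⊆ Ω ∧ UniformCauchySeqOn u atTop (ball x r)) :
    ∃ G : E → ℂ, DifferentiableOn ℂ G Ω ∧ ∀ x ∈ Ω, Tendsto (fun k => u k x) atTop (𝓝 (G x)) := by
  have hlim : ∀ x, ∃ a, x ∈ Ω → Tendsto (fun k => u k x) atTop (𝓝 a) := by
    intro x
    by_cases hx : x ∈ Ω
    · obtain ⟨r, hr, -, h⟩ := hc x hx
      obtain ⟨a, ha⟩ := cauchySeq_tendsto_of_complete (h.cauchySeq (mem_ball_self hr))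
      exact ⟨a, fun _ => ha⟩
    · exact ⟨0, fun h => absurd h hx⟩
  choose G hG using hlim
  refine ⟨G, fun x hx => ?_, hG⟩
  obtain ⟨r, hr, hsub, h⟩ := hc x hx
  have hC : UniformCauchySeqOn (fun k => fderiv ℂ (u k)) atTop (ball x (r / 2)) := by
    rw [Metric.uniformCauchySeqOn_iff] at h ⊢
    intro ε hε
    obtain ⟨N, hN⟩ := h (ε * r / 8) (by positivity)
    refine ⟨N, fun j hj k hk y hy => ?_⟩
    have hsub2 : ball y (r / 2) ⊆ ball x r := by
      apply ball_subset_ball'; rw [mem_ball] at hy; linarith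
    have hyΩ : y ∈ Ω := hsub (hsub2 (mem_ball_self (by positivity)))
    have hdj := hu j |>.differentiableAt (hΩ.mem_nhds hyΩ)
    have hdk := hu k |>.differentiableAt (hΩ.mem_nhds hyΩ)
    have hm : MapsTo (u j - u k) (ball y (r / 2)) (closedBall ((u j - u k) y) (ε * r / 4)) := by
      intro w hw
      have a1 := hN j hj k hk w (hsub2 hw)
      have a2 := hN j hj k hk y (hsub2 (mem_ball_self (by positivity)))
      rw [dist_eq_norm] at a1 a2
      rw [mem_closedBall, dist_eq_norm]
      refine (norm_sub_le _ _).trans ?_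
      simp only [Pi.sub_apply]
      linarith
    have hb := Complex.norm_fderiv_le_div_of_mapsTo_ball
      (((hu j).mono (hsub2.trans hsub)).sub ((hu k).mono (hsub2.trans hsub))) hm (by positivity)
    rw [fderiv_sub hdj hdk] at hb
    rw [dist_eq_norm]
    refine hb.trans_lt ?_
    rw [div_lt_iff₀ (by positivity)]
    nlinarith [mul_pos hε hr]
  have hlim' : ∀ y, ∃ a, y ∈ ball x (r / 2) → Tendsto (fun k => fderiv ℂ (u k) y) atTop (𝓝 a) := by
    intro y
    by_cases hy : y ∈ ball x (r / 2)
    · obtain ⟨a, ha⟩ := cauchySeq_tendsto_of_complete (hC.cauchySeq hy)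
      exact ⟨a, fun _ => ha⟩
    · exact ⟨0, fun h => absurd h hy⟩
  choose G' hG' using hlim'
  have hU := hC.tendstoUniformlyOn_of_tendsto hG'
  have hsub' : ball x (r / 2) ⊆ Ω := (ball_subset_ball (by linarith)).trans hsub
  exact (hasFDerivAt_of_tendstoUniformlyOn (𝕜 := ℂ) isOpen_ball hU
    (fun k y hy => ((hu k).differentiableAt (hΩ.mem_nhds (hsub' hy))).hasFDerivAt)
    (fun y hy => hG y (hsub' hy)) (mem_ball_self (by positivity))).differentiableAt.differentiableWithinAt

variable {E : Type*} [NormedAddCommGroup E] [NormedSpace ℂ E] [FiniteDimensional ℂ E]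
  [MeasureSpace E] [BorelSpace E] [(volume : Measure E).IsAddHaarMeasure]

/-- Integrals over a centred ball are invariant under multiplication by a unit complex scalar. -/
theorem lintegral_ball_unit_smul (c : ℂ) (hc : ‖c‖ = 1) (r : ℝ) (F : E → ℝ≥0∞) :
    ∫⁻ v in ball (0 : E) r, F (c • v) = ∫⁻ v in ball (0 : E) r, F v := by
  have hc0 : c ≠ 0 := by rintro rfl; simp at hc
  let L : E ≃ₜ E := Homeomorph.smulOfNeZero c hc0
  have hpre : ∀ s : ℝ, (fun v : E => c • v) ⁻¹' ball 0 s = ball 0 s := by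
    intro s; ext v; simp [norm_smul, hc]
  let A : E →ₗ[ℝ] E := (LinearMap.lsmul ℂ E c).restrictScalars ℝ
  have hdet : LinearMap.det A ≠ 0 := by
    have : Function.Injective A := fun x y h => smul_right_injective E hc0 h
    have h2 : IsUnit A := (Module.End.isUnit_iff A).2
      ⟨this, LinearMap.injective_iff_surjective.1 this⟩
    exact (LinearMap.isUnit_det A h2).ne_zero
  have hone : ENNReal.ofReal |(LinearMap.det A)⁻¹| = 1 := by
    have h := Measure.addHaar_preimage_linearMap (volume : Measure E) hdet (ball 0 1)
    have h3 : (A : E → E) ⁻¹' ball 0 1 = ball 0 1 := hpre 1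
    rw [h3] at h
    have hp : (volume (ball (0 : E) 1)) ≠ 0 := (measure_ball_pos _ _ one_pos).ne'
    have hf : (volume (ball (0 : E) 1)) ≠ ∞ := measure_ball_lt_top.ne
    exact ((ENNReal.mul_eq_right hp hf).1 h.symm)
  have hmp : MeasurePreserving (fun v : E => c • v) volume volume := by
    refine ⟨L.continuous.measurable, Measure.ext fun s hs => ?_⟩
    rw [Measure.map_apply (show Measurable fun v : E => c • v from L.continuous.measurable) hs]
    have h := Measure.addHaar_preimage_linearMap (volume : Measure E) hdet s
    rw [hone, one_mul] at h
    exact h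
  have h := hmp.setLIntegral_comp_preimage_emb L.measurableEmbedding F (ball 0 r)
  rwa [hpre] at h

/-- Sub-mean value property over balls for the modulus of a holomorphic function. -/
theorem enorm_mul_volume_ball_le {g : E → ℂ} {x : E} {r : ℝ}
    (hg : DifferentiableOn ℂ g (ball x r)) :
    ‖g x‖ₑ * volume (ball (0 : E) r) ≤ ∫⁻ y in ball x r, ‖g y‖ₑ := by
  have h1 : ∀ v ∈ ball (0 : E) r, ENNReal.ofReal (2 * Real.pi) * ‖g x‖ₑ ≤
      ∫⁻ θ in Ioc 0 (2 * Real.pi), ‖g (x + circleMap 0 1 θ • v)‖ₑ := by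
    intro v hv
    have hd : DiffContOnCl ℂ (fun t : ℂ => g (x + t • v)) (ball 0 |1|) := by
      apply DifferentiableOn.diffContOnCl
      apply hg.comp (by fun_prop)
      intro t ht
      have ht' : ‖t‖ ≤ 1 := by simpa [closure_ball] using ht
      have hv' : ‖v‖ < r := by simpa using hv
      simp only [mem_ball, dist_self_add_left, norm_smul]
      nlinarith [norm_nonneg v]
    have h := hd.circleAverage
    simp only [zero_smul, add_zero, Real.circleAverage_def] at h
    rw [← h, enorm_smul, intervalIntegral.integral_of_le (by positivity), ← mul_assoc]
    have : ENNReal.ofReal (2 * Real.pi) * ‖(2 * Real.pi)⁻¹‖ₑ = 1 := by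
      rw [Real.enorm_of_nonneg (by positivity), ← ENNReal.ofReal_mul (by positivity),
        mul_inv_cancel₀ (by positivity), ENNReal.ofReal_one]
    rw [this, one_mul]
    exact enorm_integral_le_lintegral_enorm _
  have hcirc : ∀ θ, ‖circleMap 0 1 θ‖ = 1 := fun θ => by simp
  have hmeas : AEMeasurable (Function.uncurry fun (v : E) (θ : ℝ) =>
      ‖g (x + circleMap 0 1 θ • v)‖ₑ) (((volume : Measure E).restrict (ball 0 r)).prod
        ((volume : Measure ℝ).restrict (Ioc 0 (2 * Real.pi)))) := by
    rw [Measure.prod_restrict]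
    refine ContinuousOn.aemeasurable ?_ (measurableSet_ball.prod measurableSet_Ioc)
    refine continuous_enorm.comp_continuousOn ?_
    refine hg.continuousOn.comp (f := fun p : E × ℝ => x + circleMap 0 1 p.2 • p.1)
      (by fun_prop) ?_
    rintro ⟨v, θ⟩ ⟨hv, -⟩
    simpa [norm_smul] using hv
  have htrans : ∫⁻ v in ball (0 : E) r, ‖g (x + v)‖ₑ = ∫⁻ y in ball x r, ‖g y‖ₑ := by
    have h := (measurePreserving_add_left (volume : Measure E) x).setLIntegral_comp_preimage_emb
      (measurableEmbedding_addLeft x) (fun y => ‖g y‖ₑ) (ball x r)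
    rw [← h]
    congr 2
    ext v; simp
  have h2 : ENNReal.ofReal (2 * Real.pi) * (‖g x‖ₑ * volume (ball (0 : E) r)) ≤
      ENNReal.ofReal (2 * Real.pi) * ∫⁻ y in ball x r, ‖g y‖ₑ := by
    calc _ = ∫⁻ _ in ball (0 : E) r, ENNReal.ofReal (2 * Real.pi) * ‖g x‖ₑ := by
          rw [setLIntegral_const]; ring
      _ ≤ ∫⁻ v in ball (0 : E) r, ∫⁻ θ in Ioc 0 (2 * Real.pi),
            ‖g (x + circleMap 0 1 θ • v)‖ₑ := setLIntegral_mono' measurableSet_ball h1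
      _ = ∫⁻ θ in Ioc 0 (2 * Real.pi), ∫⁻ v in ball (0 : E) r,
            ‖g (x + circleMap 0 1 θ • v)‖ₑ := lintegral_lintegral_swap hmeas
      _ = ∫⁻ θ in Ioc 0 (2 * Real.pi), ∫⁻ y in ball x r, ‖g y‖ₑ := by
          congr 1; ext θ
          rw [lintegral_ball_unit_smul _ (hcirc θ) r (fun v => ‖g (x + v)‖ₑ), htrans]
      _ = _ := by rw [setLIntegral_const, Real.volume_Ioc, sub_zero, mul_comm]
  exact (ENNReal.mul_le_mul_iff_right (by simp [Real.pi_pos]) ENNReal.ofReal_ne_top).1 h2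

/-- The measure `η dV` on `Ω`, so that `L^p(Ω, η)` is `Lp ℂ p (weightedMeasure Ω η)`. -/
noncomputable def weightedMeasure (Ω : Set E) (η : E → ℝ) : Measure E :=
  (volume.restrict Ω).withDensity fun x => ENNReal.ofReal (η x)

/-- The weighted Bergman space `A²(Ω, η)`: the elements of the Hilbert space `L²(Ω, η)` that are
represented by a holomorphic function on `Ω`. -/
def weightedBergmanSpace (Ω : Set E) (η : E → ℝ) :
    Submodule ℂ (Lp ℂ 2 (weightedMeasure Ω η)) where
  carrier := {f | ∃ g : E → ℂ, DifferentiableOn ℂ g Ω ∧ f =ᵐ[weightedMeasure Ω η] g}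
  zero_mem' := ⟨0, differentiableOn_const 0, Lp.coeFn_zero _ _ _⟩
  add_mem' := by
    rintro f₁ f₂ ⟨g₁, h₁, e₁⟩ ⟨g₂, h₂, e₂⟩
    exact ⟨g₁ + g₂, h₁.add h₂, (Lp.coeFn_add f₁ f₂).trans (e₁.add e₂)⟩
  smul_mem' := by
    rintro c f ⟨g, h, e⟩
    exact ⟨c • g, h.const_smul c, (Lp.coeFn_smul c f).trans (e.const_smul c)⟩

/-- Holomorphic functions are locally bounded by a constant times their `L²(Ω, η)` norm. -/
theorem exists_local_bound {Ω : Set E} {η : E → ℝ} (hΩ : IsOpen Ω) (hη : ContinuousOn η Ω)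
    (hpos : ∀ x ∈ Ω, 0 < η x) {x₀ : E} (hx₀ : x₀ ∈ Ω) :
    ∃ r > 0, ball x₀ r ⊆ Ω ∧ ∃ C : ℝ≥0∞, C ≠ ∞ ∧ ∀ g : E → ℂ, DifferentiableOn ℂ g Ω →
      ∀ x ∈ ball x₀ r, ‖g x‖ₑ ≤ C * eLpNorm g 2 (weightedMeasure Ω η) := by
  have hev : ∀ᶠ x in 𝓝 x₀, x ∈ Ω ∧ η x₀ / 2 < η x :=
    (hΩ.eventually_mem hx₀).and ((hη.continuousAt (hΩ.mem_nhds hx₀)).eventually_const_lt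
      (half_lt_self (hpos x₀ hx₀)))
  obtain ⟨R, hR, hsub⟩ := Metric.eventually_nhds_iff_ball.1 hev
  set c : ℝ≥0∞ := ENNReal.ofReal (η x₀ / 2) with hcdef
  have hc0 : c ≠ 0 := by simpa [hcdef] using hpos x₀ hx₀
  have hct : c ≠ ∞ := ENNReal.ofReal_ne_top
  have hle : (volume : Measure E).restrict (ball x₀ R) ≤ c⁻¹ • weightedMeasure Ω η := by
    refine Measure.le_iff.2 fun s hs => ?_
    rw [Measure.restrict_apply hs, Measure.smul_apply, smul_eq_mul, weightedMeasure,
      withDensity_apply _ hs, Measure.restrict_restrict hs]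
    have hm : MeasurableSet (s ∩ ball x₀ R) := hs.inter measurableSet_ball
    have h1 : c * volume (s ∩ ball x₀ R) ≤ ∫⁻ x in s ∩ Ω, ENNReal.ofReal (η x) := by
      rw [← setLIntegral_const]
      refine (setLIntegral_mono' hm fun x hx => ?_).trans
        (lintegral_mono_set (inter_subset_inter_right s fun x hx => (hsub x hx).1))
      exact ENNReal.ofReal_le_ofReal (hsub x hx.2).2.le
    calc _ = c⁻¹ * (c * volume (s ∩ ball x₀ R)) := by
          rw [← mul_assoc, ENNReal.inv_mul_cancel hc0 hct, one_mul]
      _ ≤ _ := by gcongr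
  set V := (volume : Measure E) (ball 0 (R / 2)) with hV
  have hV0 : V ≠ 0 := (measure_ball_pos _ _ (by positivity)).ne'
  have hVt : V ≠ ∞ := measure_ball_lt_top.ne
  refine ⟨R / 2, by positivity, fun x hx => (hsub x (ball_subset_ball (by linarith) hx)).1,
    V⁻¹ * (c⁻¹ ^ (1 / (2 : ℝ≥0∞)).toReal * volume (ball x₀ R) ^ ((1 : ℝ) / 1 - 1 / 2)), ?_, ?_⟩
  · refine ENNReal.mul_ne_top (ENNReal.inv_ne_top.2 hV0) (ENNReal.mul_ne_top ?_ ?_)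
    · exact ENNReal.rpow_ne_top_of_nonneg (by simp) (ENNReal.inv_ne_top.2 hc0)
    · exact ENNReal.rpow_ne_top_of_nonneg (by norm_num) measure_ball_lt_top.ne
  · intro g hg x hx
    have hs1 : ball x (R / 2) ⊆ ball x₀ R := by
      apply ball_subset_ball'; rw [mem_ball] at hx; linarith
    have hs2 : ball x₀ R ⊆ Ω := fun y hy => (hsub y hy).1
    have h1 := enorm_mul_volume_ball_le (hg.mono (hs1.trans hs2))
    have h2 : ∫⁻ y in ball x (R / 2), ‖g y‖ₑ ≤
        eLpNorm g 1 ((volume : Measure E).restrict (ball x₀ R)) := by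
      rw [eLpNorm_one_eq_lintegral_enorm]
      exact lintegral_mono_set hs1
    have hgm : AEStronglyMeasurable g ((volume : Measure E).restrict (ball x₀ R)) :=
      (hg.mono hs2).continuousOn.aestronglyMeasurable measurableSet_ball
    have h3 := eLpNorm_le_eLpNorm_mul_rpow_measure_univ (p := 1) (q := 2) one_le_two hgm
    have h4 : eLpNorm g 2 ((volume : Measure E).restrict (ball x₀ R)) ≤
        c⁻¹ ^ (1 / (2 : ℝ≥0∞)).toReal * eLpNorm g 2 (weightedMeasure Ω η) := by
      refine (eLpNorm_mono_measure g hle).trans_eq ?_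
      rw [eLpNorm_smul_measure_of_ne_top (by simp), smul_eq_mul]
    simp only [Measure.restrict_apply_univ, ENNReal.toReal_one, ENNReal.toReal_ofNat] at h3
    have h5 : ‖g x‖ₑ = V⁻¹ * (‖g x‖ₑ * V) := by
      rw [mul_comm ‖g x‖ₑ, ← mul_assoc, ENNReal.inv_mul_cancel hV0 hVt, one_mul]
    rw [h5]
    calc V⁻¹ * (‖g x‖ₑ * V) ≤ V⁻¹ * (c⁻¹ ^ (1 / (2 : ℝ≥0∞)).toReal *
            eLpNorm g 2 (weightedMeasure Ω η) * volume (ball x₀ R) ^ ((1 : ℝ) / 1 - 1 / 2)) := by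
          refine mul_le_mul_right ?_ _
          refine (h1.trans (h2.trans h3)).trans ?_
          gcongr
      _ = _ := by ring

/-- `A²(Ω, η)` is closed in `L²(Ω, η)` when `Ω` is open and `η` is continuous and positive on `Ω`. -/
theorem isClosed_weightedBergmanSpace {Ω : Set E} {η : E → ℝ} (hΩ : IsOpen Ω)
    (hη : ContinuousOn η Ω) (hpos : ∀ x ∈ Ω, 0 < η x) :
    IsClosed (weightedBergmanSpace Ω η : Set (Lp ℂ 2 (weightedMeasure Ω η))) := by
  refine IsSeqClosed.isClosed fun f f₀ hf hlim => ?_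
  choose u hu hfu using hf
  have hnorm : ∀ j k, eLpNorm (u j - u k) 2 (weightedMeasure Ω η) = edist (f j) (f k) := by
    intro j k
    rw [Lp.edist_def]
    exact eLpNorm_congr_ae ((hfu j).symm.sub (hfu k).symm)
  have hcauchy : ∀ x ∈ Ω, ∃ r > 0, ball x r ⊆ Ω ∧ UniformCauchySeqOn u atTop (ball x r) := by
    intro x hx
    obtain ⟨r, hr, hsub, C, hC, hb⟩ := exists_local_bound hΩ hη hpos hx
    refine ⟨r, hr, hsub, ?_⟩
    rw [Metric.uniformCauchySeqOn_iff]
    intro ε hε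
    have hδ : 0 < ENNReal.ofReal ε / (C + 1) :=
      ENNReal.div_pos (by simpa using hε) (by simp [hC])
    obtain ⟨N, hN⟩ := EMetric.cauchySeq_iff.1 hlim.cauchySeq _ hδ
    refine ⟨N, fun j hj k hk y hy => ?_⟩
    have h1 := hb (u j - u k) ((hu j).sub (hu k)) y hy
    rw [hnorm] at h1
    have h2 : edist (u j y) (u k y) < ENNReal.ofReal ε := by
      rw [edist_eq_enorm_sub]
      refine h1.trans_lt (lt_of_le_of_lt (mul_le_mul_left (le_self_add (a := C) (b := 1)) _) ?_)
      rw [mul_comm]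
      exact (ENNReal.lt_div_iff_mul_lt (Or.inl (by simp)) (Or.inl (by simp [hC]))).1
        (hN j hj k hk)
    rw [edist_dist] at h2
    exact (ENNReal.ofReal_lt_ofReal_iff hε).1 h2
  obtain ⟨G, hG, hGlim⟩ := exists_differentiableOn_limit hΩ hu hcauchy
  refine ⟨G, hG, ?_⟩
  obtain ⟨φ, hφ, hae⟩ := (tendstoInMeasure_of_tendsto_Lp hlim).exists_seq_tendsto_ae
  have hmem : ∀ᵐ x ∂weightedMeasure Ω η, x ∈ Ω :=
    (withDensity_absolutelyContinuous _ _).ae_le (ae_restrict_mem hΩ.measurableSet)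
  filter_upwards [hae, hmem, ae_all_iff.2 hfu] with x hx hxΩ hxu
  refine tendsto_nhds_unique hx ?_
  simp only [hxu]
  exact (hGlim x hxΩ).comp hφ.tendsto_atTop

/-- The weighted Bergman projection `P_{Ω, η}`: the orthogonal projection of `L²(Ω, η)` onto its
closed subspace `A²(Ω, η)`, for `Ω` open and `η` continuous and positive on `Ω`. -/
noncomputable def weightedBergmanProjection (Ω : Set E) (η : E → ℝ) (hΩ : IsOpen Ω)
    (hη : ContinuousOn η Ω) (hpos : ∀ x ∈ Ω, 0 < η x) :
    Lp ℂ 2 (weightedMeasure Ω η) →L[ℂ] Lp ℂ 2 (weightedMeasure Ω η) :=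
  haveI : CompleteSpace (weightedBergmanSpace Ω η) :=
    (isClosed_weightedBergmanSpace hΩ hη hpos).completeSpace_coe
  (weightedBergmanSpace Ω η).starProjection

/-- An operator `P` on `L²(ν)` is bounded on `L^p(ν)`: it maps `L^p ∩ L²` to `L^p`, and
`‖P f‖_p ≤ C ‖f‖_p` for all `f ∈ L^p ∩ L²`, with a constant `C` independent of `f`. -/
def IsLpBounded {X : Type*} [MeasurableSpace X] {ν : Measure X} (P : Lp ℂ 2 ν → Lp ℂ 2 ν)
    (p : ℝ) : Prop :=
  ∃ C : ℝ≥0, ∀ f : Lp ℂ 2 ν, MemLp f (ENNReal.ofReal p) ν →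
    MemLp (P f) (ENNReal.ofReal p) ν ∧
      eLpNorm (P f) (ENNReal.ofReal p) ν ≤ C * eLpNorm f (ENNReal.ofReal p) ν
end General

section Domain

open MeasureTheory

/-- The squared Hermitian norm `‖v‖² = ∑ |v_i|²` on `ℂ^k`. -/
noncomputable def normSq {k : ℕ} (v : Fin k → ℂ) : ℝ := ∑ i, ‖v i‖ ^ 2

/-- The function `ρ(z, w) = ‖w‖² - exp (-μ ‖z‖²)` on `ℂ^n × ℂ^m`. -/
noncomputable def rho (n m : ℕ) (μ : ℝ) (x : (Fin n → ℂ) × (Fin m → ℂ)) : ℝ :=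
  normSq x.2 - Real.exp (-μ * normSq x.1)

/-- The Fock-Bargmann-Hartogs domain `D_{n,m}(μ) = {(z, w) : ‖w‖² < exp (-μ ‖z‖²)}`. -/
def domain (n m : ℕ) (μ : ℝ) : Set ((Fin n → ℂ) × (Fin m → ℂ)) :=
  {x | normSq x.2 < Real.exp (-μ * normSq x.1)}

/-- The weight `(-ρ)^α`. -/
noncomputable def weight (n m : ℕ) (μ α : ℝ) (x : (Fin n → ℂ) × (Fin m → ℂ)) : ℝ :=
  (-rho n m μ x) ^ α

theorem continuous_normSq {k : ℕ} : Continuous (normSq : (Fin k → ℂ) → ℝ) := by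
  unfold normSq; fun_prop

theorem continuous_rho (n m : ℕ) (μ : ℝ) : Continuous (rho n m μ) := by
  have h1 := continuous_normSq (k := n)
  have h2 := continuous_normSq (k := m)
  unfold rho; fun_prop

theorem neg_rho_pos {n m : ℕ} {μ : ℝ} {x : (Fin n → ℂ) × (Fin m → ℂ)}
    (hx : x ∈ domain n m μ) : 0 < -rho n m μ x := by
  rw [rho, neg_sub]; exact sub_pos.2 hx

theorem isOpen_domain (n m : ℕ) (μ : ℝ) : IsOpen (domain n m μ) := by
  have h1 := continuous_normSq (k := n)
  have h2 := continuous_normSq (k := m)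
  exact isOpen_lt (by fun_prop) (by fun_prop)

theorem continuousOn_weight (n m : ℕ) (μ α : ℝ) :
    ContinuousOn (weight n m μ α) (domain n m μ) :=
  (continuous_rho n m μ).neg.continuousOn.rpow_const fun _ hx => Or.inl (neg_rho_pos hx).ne'

theorem weight_pos (n m : ℕ) (μ α : ℝ) : ∀ x ∈ domain n m μ, 0 < weight n m μ α x :=
  fun _ hx => Real.rpow_pos_of_pos (neg_rho_pos hx) α

/-- Lebesgue measure on `ℂ^n × ℂ^m` is a Haar measure. -/
instance isAddHaarMeasure_volume (n m : ℕ) :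
    (volume : Measure ((Fin n → ℂ) × (Fin m → ℂ))).IsAddHaarMeasure :=
  Measure.prod.instIsAddHaarMeasure _ _

/-- The weighted Bergman projection of `D_{n,m}(μ)` with the weight `(-ρ)^α`. -/
noncomputable def projection (n m : ℕ) (μ α : ℝ) :
    Lp ℂ 2 (weightedMeasure (domain n m μ) (weight n m μ α)) →L[ℂ]
      Lp ℂ 2 (weightedMeasure (domain n m μ) (weight n m μ α)) :=
  weightedBergmanProjection (domain n m μ) (weight n m μ α) (isOpen_domain n m μ)
    (continuousOn_weight n m μ α) (weight_pos n m μ α)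

/-- The ordinary Bergman projection of `D_{n,m}(μ)`, with the weight `1`. -/
noncomputable def ordinaryProjection (n m : ℕ) (μ : ℝ) :
    Lp ℂ 2 (weightedMeasure (domain n m μ) fun _ => 1) →L[ℂ]
      Lp ℂ 2 (weightedMeasure (domain n m μ) fun _ => 1) :=
  weightedBergmanProjection (domain n m μ) (fun _ => 1) (isOpen_domain n m μ)
    continuousOn_const (fun _ _ => one_pos)

end Domain

end FockBargmannHartogs

/-!
Functions of `z` alone already decide the question. Integrating the weight `(-ρ)^α` over the fibre
`‖w‖² < exp (-μ ‖z‖²)` leaves a constant times the Gaussian `exp (-a ‖z‖²)` with `a = μ (α + m) > 0`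
(`map_fst_weightedMeasure`), so such functions form an `L^p` space of that Gaussian on `ℂ^n`, for
every `p` with the same `a`. On them the Bergman projection is the projection onto the Fock space.

The test functions are `f = z_i^N exp (-c ‖z‖²)`, with `c` real of either sign. A holomorphic
function `h` on the domain pairs with `f` only through `H z = h (z, 0)`, by the mean value property
in `w`, and `H` only through its homogeneous part of degree `N`, by averaging over `z ↦ exp (iθ) z`.
For this part the dilation of `ℂ^n` that turns `exp (-(a + c) ‖z‖²)` into `exp (-a ‖z‖²)` gives
`P f = s^(N + n) z_i^N` with `s = a / (a + c)` (`projection_monomialGaussian`). The same dilation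
gives `‖f‖_p = t^(N / 2 + n / p) ‖z_i^N‖_p` with `t = a / (a + p c)` (`gaussianMoment_eq_mul`).
A bound on `L^p` therefore forces `s ≤ √t`, that is `c² ≥ (p - 2) a c`, for all admissible `c`; this
fails for small `c ≠ 0` with the sign of `p - 2` unless `p = 2`. For `p = 2` the projection is a
contraction.
-/

namespace FockBargmannHartogs

open MeasureTheory Set Filter Topology
open scoped ENNReal NNReal ComplexConjugate

/-! ### Scaling and polar coordinates for the Hermitian norm -/

theorem normSq_nonneg {k : ℕ} (v : Fin k → ℂ) : 0 ≤ normSq v :=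
  Finset.sum_nonneg fun _ _ => by positivity

theorem normSq_real_smul {k : ℕ} (t : ℝ) (v : Fin k → ℂ) : normSq (t • v) = t ^ 2 * normSq v := by
  simp [normSq, mul_pow, Finset.mul_sum]

theorem normSq_complex_smul {k : ℕ} (c : ℂ) (v : Fin k → ℂ) :
    normSq (c • v) = ‖c‖ ^ 2 * normSq v := by
  simp [normSq, mul_pow, Finset.mul_sum]

theorem norm_apply_sq_le_normSq {k : ℕ} (v : Fin k → ℂ) (i : Fin k) : ‖v i‖ ^ 2 ≤ normSq v :=
  Finset.single_le_sum (f := fun i => ‖v i‖ ^ 2) (fun _ _ => by positivity) (Finset.mem_univ i)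

theorem finrank_real_fin_complex (k : ℕ) : Module.finrank ℝ (Fin k → ℂ) = 2 * k := by
  rw [Module.finrank_pi_fintype]; simp [mul_comm]

theorem lintegral_comp_real_smul {k : ℕ} {t : ℝ} (ht : 0 < t) (F : (Fin k → ℂ) → ℝ≥0∞) :
    ∫⁻ v, F (t • v) = ENNReal.ofReal ((t ^ (2 * k))⁻¹) * ∫⁻ v, F v := by
  have h := Measure.map_addHaar_smul (volume : Measure (Fin k → ℂ)) ht.ne'
  have he : MeasurableEmbedding (fun v : Fin k → ℂ => t • v) :=
    (Homeomorph.smulOfNeZero t ht.ne').measurableEmbedding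
  rw [← he.lintegral_map, h, lintegral_smul_measure, finrank_real_fin_complex,
    abs_of_pos (by positivity), smul_eq_mul]

/-- Integration in polar coordinates for functions of the Hermitian norm. -/
theorem integrable_comp_normSq {k : ℕ} (hk : 1 ≤ k) {f : ℝ → ℝ}
    (hf : IntegrableOn (fun y => y ^ (2 * k - 1) * f (y ^ 2)) (Ioi 0)) :
    Integrable fun v : Fin k → ℂ => f (normSq v) := by
  have : Nonempty (Fin k) := ⟨⟨0, hk⟩⟩
  -- `Fin k → ℂ` carries the sup norm, so the Hermitian norm is read off on `EuclideanSpace`.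
  let e : (Fin k → ℂ) ≃L[ℝ] EuclideanSpace ℂ (Fin k) :=
    (PiLp.continuousLinearEquiv 2 ℝ fun _ : Fin k => ℂ).symm
  have he := e.isAddHaarMeasure_map (volume : Measure (Fin k → ℂ))
  have hdim : Module.finrank ℝ (EuclideanSpace ℂ (Fin k)) = 2 * k := by
    rw [← e.toLinearEquiv.finrank_eq, finrank_real_fin_complex]
  have hnorm : ∀ v, ‖e v‖ ^ 2 = normSq v := fun v => by
    rw [EuclideanSpace.norm_sq_eq]; rfl
  have h := (integrable_fun_norm_addHaar (Measure.map e (volume : Measure (Fin k → ℂ)))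
    (f := fun y => f (y ^ 2))).2 (by simpa [hdim] using hf)
  have h2 := (e.toHomeomorph.measurableEmbedding.integrable_map_iff
    (μ := (volume : Measure (Fin k → ℂ)))).1 h
  exact h2.congr (ae_of_all _ fun v => by
    simp only [Function.comp_apply]
    exact congrArg f (hnorm v))

/-! ### The fibre integral of the weight -/

/-- The integral of the weight over the fibre `{‖u‖ < 1}` of the domain above `z = 0`. -/
noncomputable def fiberMass (m : ℕ) (α : ℝ) : ℝ≥0∞ :=
  ∫⁻ u : Fin m → ℂ, {u | normSq u < 1}.indicator (fun u => ENNReal.ofReal ((1 - normSq u) ^ α)) u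

/-- The factorization `(1 - y²)^α = (1 + y)^α (1 - y)^α` reduces this to the integrability of
`(1 - y)^α` at `y = 1`, where `α > -1` enters. -/
theorem fiberMass_ne_top {m : ℕ} (hm : 1 ≤ m) {α : ℝ} (hα : -1 < α) : fiberMass m α ≠ ∞ := by
  have h1 : IntegrableOn (fun y : ℝ => (1 - y) ^ α) (Ioo 0 1) := by
    have h := (intervalIntegral.intervalIntegrable_rpow' (a := 0) (b := 1) hα).comp_sub_left 1
    have h := h.symm
    simp only [sub_zero, sub_self] at h
    exact ((intervalIntegrable_iff_integrableOn_Ioc_of_le zero_le_one).1 h).mono_set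
      Ioo_subset_Ioc_self
  have h2 : IntegrableOn (fun y : ℝ => y ^ (2 * m - 1) * (1 + y) ^ α * (1 - y) ^ α) (Ioo 0 1) := by
    refine Integrable.bdd_mul (c := 2 ^ |α|) h1 (ContinuousOn.aestronglyMeasurable ?_
      measurableSet_Ioo) ((ae_restrict_iff' measurableSet_Ioo).2 (ae_of_all _ fun y hy => ?_))
    · refine (continuousOn_id.pow _).mul (ContinuousOn.rpow_const (by fun_prop) fun y hy => ?_)
      exact Or.inl (by linarith [hy.1])
    · have hy1 : (0 : ℝ) < 1 + y := by linarith [hy.1]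
      rw [Real.norm_of_nonneg (mul_nonneg (pow_nonneg hy.1.le _) (Real.rpow_nonneg hy1.le _))]
      calc y ^ (2 * m - 1) * (1 + y) ^ α ≤ 1 * (1 + y) ^ |α| := by
            gcongr
            · exact pow_le_one₀ hy.1.le hy.2.le
            · linarith [hy.1]
            · exact le_abs_self α
        _ ≤ 2 ^ |α| := by
            rw [one_mul]; exact Real.rpow_le_rpow hy1.le (by linarith [hy.2]) (abs_nonneg _)
  have h3 : Integrable fun u : Fin m → ℂ =>
      (Iio (1 : ℝ)).indicator (fun s => (1 - s) ^ α) (normSq u) := by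
    refine integrable_comp_normSq hm ?_
    have h4 : IntegrableOn ((Ioo (0 : ℝ) 1).indicator fun y : ℝ =>
        y ^ (2 * m - 1) * (1 + y) ^ α * (1 - y) ^ α) (Ioi 0) :=
      ((integrable_indicator_iff measurableSet_Ioo).2 h2).integrableOn
    refine h4.congr_fun (fun y hy => ?_) measurableSet_Ioi
    have hy : (0 : ℝ) < y := hy
    by_cases hy1 : y < 1
    · have : y ^ 2 < 1 := by nlinarith
      simp only [indicator, mem_Ioo, hy, hy1, mem_Iio, this, and_self, if_true]
      rw [mul_assoc, ← Real.mul_rpow (by linarith) (by linarith)]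
      ring_nf
    · have : ¬ y ^ 2 < 1 := by nlinarith
      simp [indicator, hy1, this]
  refine ne_of_lt (lt_of_le_of_lt (lintegral_mono fun u => ?_) h3.2)
  by_cases hu : normSq u < 1
  · simpa [indicator, hu] using Real.ofReal_le_enorm _
  · simp [indicator, hu]

theorem fiberMass_ne_zero (m : ℕ) (α : ℝ) : fiberMass m α ≠ 0 := by
  have hc := continuous_normSq (k := m)
  have ho : IsOpen {u : Fin m → ℂ | normSq u < 1} := isOpen_lt hc continuous_const
  rw [fiberMass, lintegral_indicator ho.measurableSet]
  refine (setLIntegral_pos_iff ?_).2 ?_ |>.ne'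
  · exact (Measurable.pow_const (by fun_prop) _).ennreal_ofReal
  · refine (ho.measure_pos volume ⟨0, by simp [normSq]⟩).trans_le (measure_mono fun u hu => ⟨?_, hu⟩)
    have : (0 : ℝ) < 1 - normSq u := sub_pos.2 hu
    simpa using Real.rpow_pos_of_pos this α

theorem lintegral_fiber (m : ℕ) (α : ℝ) {R : ℝ} (hR : 0 < R) :
    ∫⁻ w : Fin m → ℂ, {w | normSq w < R}.indicator (fun w => ENNReal.ofReal ((R - normSq w) ^ α)) w
      = ENNReal.ofReal (R ^ (α + m)) * fiberMass m α := by
  have hs : 0 < √R := Real.sqrt_pos.2 hR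
  have h := lintegral_comp_real_smul hs fun w : Fin m → ℂ =>
    {w | normSq w < R}.indicator (fun w => ENNReal.ofReal ((R - normSq w) ^ α)) w
  have h2 : ∀ u : Fin m → ℂ, {w | normSq w < R}.indicator
      (fun w => ENNReal.ofReal ((R - normSq w) ^ α)) (√R • u) = ENNReal.ofReal (R ^ α) *
        {u | normSq u < 1}.indicator (fun u => ENNReal.ofReal ((1 - normSq u) ^ α)) u := by
    intro u
    have hiff : R * normSq u < R ↔ normSq u < 1 := by
      constructor <;> intro h <;> nlinarith
    by_cases hu : normSq u < 1
    · simp only [indicator, mem_ofPred_eq, normSq_real_smul, Real.sq_sqrt hR.le, hiff, hu, if_true]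
      rw [← ENNReal.ofReal_mul (by positivity), ← Real.mul_rpow hR.le (by linarith)]
      ring_nf
    · simp [indicator, normSq_real_smul, Real.sq_sqrt hR.le, hiff, hu]
  simp_rw [h2] at h
  rw [lintegral_const_mul' _ _ ENNReal.ofReal_ne_top, pow_mul, Real.sq_sqrt hR.le] at h
  have h3 := congrArg (ENNReal.ofReal (R ^ m) * ·) h
  rw [← mul_assoc, ← mul_assoc, ← ENNReal.ofReal_mul (by positivity),
    ← ENNReal.ofReal_mul (by positivity), mul_inv_cancel₀ (by positivity), ENNReal.ofReal_one,
    one_mul] at h3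
  rw [← h3, fiberMass, Real.rpow_add hR, Real.rpow_natCast, mul_comm (R ^ m)]

/-- The Gaussian measure `exp (-b ‖z‖²) dz` on `ℂ^n`, without normalization. -/
noncomputable def gaussianMeasure (n : ℕ) (b : ℝ) : Measure (Fin n → ℂ) :=
  volume.withDensity fun z => ENNReal.ofReal (Real.exp (-b * normSq z))

theorem measurable_gaussian (n : ℕ) (b : ℝ) :
    Measurable fun z : Fin n → ℂ => ENNReal.ofReal (Real.exp (-b * normSq z)) := by
  have hc := continuous_normSq (k := n)
  exact (by fun_prop : Continuous fun z : Fin n → ℂ =>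
    Real.exp (-b * normSq z)).measurable.ennreal_ofReal

theorem measurable_normSq (k : ℕ) : Measurable (normSq : (Fin k → ℂ) → ℝ) :=
  continuous_normSq.measurable

theorem measurable_weight (n m : ℕ) (μ α : ℝ) : Measurable (weight n m μ α) :=
  (continuous_rho n m μ).measurable.neg.pow_const α

/-- Integrating out `w` turns the weight into a Gaussian: this is how the Fock spaces enter. -/
theorem map_fst_weightedMeasure (n m : ℕ) (μ α : ℝ) :
    Measure.map Prod.fst (weightedMeasure (domain n m μ) (weight n m μ α)) =
      fiberMass m α • gaussianMeasure n (μ * (α + m)) := by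
  have hD := (isOpen_domain n m μ).measurableSet
  refine Measure.ext_of_lintegral _ fun F hF => ?_
  rw [lintegral_map hF measurable_fst, lintegral_smul_measure, gaussianMeasure]
  change ∫⁻ x, (F ∘ Prod.fst) x ∂_ = _
  rw [lintegral_withDensity_eq_lintegral_mul _ (measurable_gaussian _ _) hF, weightedMeasure,
    lintegral_withDensity_eq_lintegral_mul _ (measurable_weight n m μ α).ennreal_ofReal
      (hF.comp measurable_fst), ← lintegral_indicator hD, Measure.volume_eq_prod,
    lintegral_prod _ (Measurable.aemeasurable ?_), smul_eq_mul, ← lintegral_const_mul]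
  · congr 1; ext z
    have hR := Real.exp_pos (-μ * normSq z)
    have h := lintegral_fiber m α hR
    rw [← Real.exp_mul, show -μ * normSq z * (α + m) = -(μ * (α + m)) * normSq z by ring] at h
    simp only [Pi.mul_apply]
    rw [show fiberMass m α * (ENNReal.ofReal (Real.exp (-(μ * (α + m)) * normSq z)) * F z) =
      F z * (ENNReal.ofReal (Real.exp (-(μ * (α + m)) * normSq z)) * fiberMass m α) by ring, ← h,
      ← lintegral_const_mul]
    · congr 1; ext w
      simp [indicator, domain, weight, rho, mul_comm]
    · refine Measurable.indicator (Measurable.ennreal_ofReal (Measurable.pow_const ?_ _)) ?_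
      · exact measurable_const.sub (measurable_normSq m)
      · exact measurableSet_lt (measurable_normSq m) measurable_const
  · exact (measurable_gaussian _ _).mul hF
  · exact ((measurable_weight n m μ α).ennreal_ofReal.mul (hF.comp measurable_fst)).indicator hD

/-! ### Gaussian moments and the test functions -/

/-- The absolute moment `∫ |z_i|^s exp (-b ‖z‖²) dz` over `ℂ^n`. -/
noncomputable def gaussianMoment {n : ℕ} (i : Fin n) (s b : ℝ) : ℝ≥0∞ :=
  ∫⁻ z : Fin n → ℂ, ENNReal.ofReal (‖z i‖ ^ s * Real.exp (-b * normSq z))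

/-- The dilation `z ↦ √(a / b) z` turns the Gaussian of parameter `b` into that of parameter `a`. -/
theorem gaussianMoment_eq_mul {n : ℕ} (i : Fin n) (s : ℝ) {a b : ℝ} (ha : 0 < a) (hb : 0 < b) :
    gaussianMoment i s b = ENNReal.ofReal ((a / b) ^ (s / 2 + n)) * gaussianMoment i s a := by
  have hab : 0 < a / b := div_pos ha hb
  have ht : 0 < √(a / b) := Real.sqrt_pos.2 hab
  have h := lintegral_comp_real_smul ht fun z : Fin n → ℂ =>
    ENNReal.ofReal (‖z i‖ ^ s * Real.exp (-b * normSq z))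
  have h2 : ∀ z : Fin n → ℂ, ENNReal.ofReal (‖(√(a / b) • z) i‖ ^ s *
      Real.exp (-b * normSq (√(a / b) • z))) = ENNReal.ofReal ((a / b) ^ (s / 2)) *
        ENNReal.ofReal (‖z i‖ ^ s * Real.exp (-a * normSq z)) := by
    intro z
    have hpow : √(a / b) ^ s = (a / b) ^ (s / 2) := by
      rw [Real.sqrt_eq_rpow, ← Real.rpow_mul hab.le]; congr 1; ring
    rw [normSq_real_smul, Real.sq_sqrt hab.le, Pi.smul_apply, norm_smul,
      Real.norm_of_nonneg ht.le, Real.mul_rpow ht.le (norm_nonneg _), hpow,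
      ← ENNReal.ofReal_mul (by positivity), mul_assoc,
      show -b * (a / b * normSq z) = -a * normSq z by field_simp]
  simp_rw [h2] at h
  rw [lintegral_const_mul' _ _ ENNReal.ofReal_ne_top, pow_mul, Real.sq_sqrt hab.le] at h
  have h3 := congrArg (ENNReal.ofReal ((a / b) ^ n) * ·) h
  rw [← mul_assoc, ← mul_assoc, ← ENNReal.ofReal_mul (by positivity),
    ← ENNReal.ofReal_mul (by positivity), mul_inv_cancel₀ (by positivity), ENNReal.ofReal_one,
    one_mul] at h3
  rw [gaussianMoment, ← h3, gaussianMoment, Real.rpow_add hab, Real.rpow_natCast,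
    mul_comm ((a / b) ^ n)]

theorem gaussianMoment_ne_top {n : ℕ} (i : Fin n) {s b : ℝ} (hs : 0 ≤ s) (hb : 0 < b) :
    gaussianMoment i s b ≠ ∞ := by
  have hn : 1 ≤ n := i.pos
  have h1 : Integrable fun z : Fin n → ℂ => normSq z ^ (s / 2) * Real.exp (-b * normSq z) := by
    refine integrable_comp_normSq (f := fun r => r ^ (s / 2) * Real.exp (-b * r)) hn ?_
    have h := integrableOn_rpow_mul_exp_neg_mul_sq hb (s := ((2 * n - 1 : ℕ) : ℝ) + s)
      (by have : (0 : ℝ) ≤ ((2 * n - 1 : ℕ) : ℝ) := by positivity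
          linarith)
    refine h.congr_fun (fun y hy => ?_) measurableSet_Ioi
    have hy : (0 : ℝ) < y := hy
    simp only
    rw [Real.rpow_add hy, Real.rpow_natCast, ← Real.rpow_natCast y 2, ← Real.rpow_mul hy.le,
      mul_assoc]
    congr 3
    push_cast; ring
  refine ne_of_lt (lt_of_le_of_lt (lintegral_mono fun z => ?_) h1.2)
  refine (ENNReal.ofReal_le_ofReal
    (mul_le_mul_of_nonneg_right ?_ (Real.exp_pos _).le)).trans (Real.ofReal_le_enorm _)
  calc ‖z i‖ ^ s = (‖z i‖ ^ 2) ^ (s / 2) := by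
        rw [← Real.rpow_natCast, ← Real.rpow_mul (norm_nonneg _)]; congr 1; push_cast; ring
    _ ≤ _ := Real.rpow_le_rpow (by positivity) (norm_apply_sq_le_normSq z i) (by positivity)

theorem gaussianMoment_ne_zero {n : ℕ} (i : Fin n) (s b : ℝ) : gaussianMoment i s b ≠ 0 := by
  have hc := continuous_normSq (k := n)
  have ho : IsOpen {z : Fin n → ℂ | z i ≠ 0} := isOpen_ne_fun (by fun_prop) continuous_const
  refine ((lintegral_pos_iff_support ?_).2 ?_).ne'
  · refine (Measurable.mul (Measurable.pow_const (by fun_prop) _) ?_).ennreal_ofReal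
    exact (by fun_prop : Continuous fun z : Fin n → ℂ => Real.exp (-b * normSq z)).measurable
  · refine (ho.measure_pos volume ⟨fun _ => 1, by simp⟩).trans_le (measure_mono fun z hz => ?_)
    have : 0 < ‖z i‖ := norm_pos_iff.2 hz
    have : 0 < ‖z i‖ ^ s * Real.exp (-b * normSq z) := by positivity
    simpa using this

/-- The test function `z_i^N exp (-c ‖z‖²)` on `ℂ^n`. -/
noncomputable def monomialGaussian {n : ℕ} (i : Fin n) (N : ℕ) (c : ℝ) (z : Fin n → ℂ) : ℂ :=
  z i ^ N * (Real.exp (-c * normSq z) : ℝ)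

theorem continuous_monomialGaussian {n : ℕ} (i : Fin n) (N : ℕ) (c : ℝ) :
    Continuous (monomialGaussian i N c) := by
  have hc := continuous_normSq (k := n)
  unfold monomialGaussian
  fun_prop

theorem eLpNorm_monomialGaussian {n : ℕ} (i : Fin n) (N : ℕ) (c b : ℝ) {q : ℝ} (hq : 0 < q) :
    eLpNorm (monomialGaussian i N c) (ENNReal.ofReal q) (gaussianMeasure n b) =
      gaussianMoment i (N * q) (b + q * c) ^ (1 / q) := by
  rw [eLpNorm_eq_lintegral_rpow_enorm_toReal (by simpa using hq) ENNReal.ofReal_ne_top,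
    ENNReal.toReal_ofReal hq.le, gaussianMeasure, lintegral_withDensity_eq_lintegral_mul _
      (measurable_gaussian n b)
      ((continuous_monomialGaussian i N c).measurable.enorm.pow_const q), gaussianMoment]
  congr 2; ext z
  simp only [Pi.mul_apply]
  rw [← ofReal_norm, ENNReal.ofReal_rpow_of_nonneg (norm_nonneg _) hq.le,
    ← ENNReal.ofReal_mul (by positivity), monomialGaussian, norm_mul, norm_pow,
    Complex.norm_real, Real.norm_of_nonneg (Real.exp_pos _).le,
    Real.mul_rpow (by positivity) (by positivity), ← Real.exp_mul, ← Real.rpow_natCast,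
    ← Real.rpow_mul (norm_nonneg _), mul_left_comm, ← Real.exp_add]
  ring_nf

theorem memLp_monomialGaussian {n : ℕ} (i : Fin n) (N : ℕ) {c b : ℝ} {q : ℝ} (hq : 0 < q)
    (h : 0 < b + q * c) :
    MemLp (monomialGaussian i N c) (ENNReal.ofReal q) (gaussianMeasure n b) := by
  refine ⟨(continuous_monomialGaussian i N c).aestronglyMeasurable, ?_⟩
  rw [eLpNorm_monomialGaussian i N c b hq]
  exact ENNReal.rpow_lt_top_of_nonneg (by positivity)
    (gaussianMoment_ne_top i (by positivity) h)

/-! ### Averaging over circles -/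

/-- Averaging an integrable function over a measure preserving family of maps. -/
theorem integral_eq_integral_average {X : Type*} [MeasurableSpace X] {ν : Measure X} [SFinite ν]
    {R : ℝ → X → X} (hR : ∀ θ, MeasurePreserving (R θ) ν ν)
    (hRm : Measurable (Function.uncurry R)) {F : X → ℂ} (hF : Integrable F ν) :
    Integrable (fun x => ∫ θ in (0)..2 * Real.pi, F (R θ x)) ν ∧
      2 * Real.pi * ∫ x, F x ∂ν = ∫ x, (∫ θ in (0)..2 * Real.pi, F (R θ x)) ∂ν := by
  have h2pi : (0 : ℝ) ≤ 2 * Real.pi := by positivity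
  simp_rw [intervalIntegral.integral_of_le h2pi]
  set κ := (volume : Measure ℝ).restrict (Ioc 0 (2 * Real.pi)) with hκ
  have hmp : MeasurePreserving (fun p : ℝ × X => (id p.1, R p.1 p.2)) (κ.prod ν) (κ.prod ν) :=
    (MeasurePreserving.id κ).skew_product hRm (ae_of_all _ fun θ => (hR θ).map_eq)
  have hint : Integrable (fun p : ℝ × X => F (R p.1 p.2)) (κ.prod ν) :=
    hmp.integrable_comp_of_integrable (hF.comp_snd κ)
  refine ⟨hint.integral_prod_right, ?_⟩
  have e1 := integral_prod_symm _ hint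
  have e2 := integral_prod _ hint
  have e3 : ∀ᵐ θ ∂κ, ∫ x, F (R θ x) ∂ν = ∫ x, F x ∂ν := ae_of_all _ fun θ => by
    have h := integral_map (μ := ν) (hR θ).measurable.aemeasurable
      (f := F) (by rw [(hR θ).map_eq]; exact hF.aestronglyMeasurable)
    rw [← h, (hR θ).map_eq]
  rw [← e1, e2, integral_congr_ae e3, integral_const]
  simp [hκ, Real.pi_pos.le]

theorem measurePreserving_unit_smul {k : ℕ} (c : Circle) :
    MeasurePreserving (fun v : Fin k → ℂ => (c : ℂ) • v) volume volume :=
  volume_preserving_pi fun _ => (rotation c).measurePreserving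

/-- A map that preserves a measure preserves each of its multiples by an invariant density. -/
theorem MeasurePreserving.withDensity_of_comp_eq {X : Type*} [MeasurableSpace X] {ν : Measure X}
    {T : X → X} (hT : MeasurePreserving T ν ν) {η : X → ℝ≥0∞} (hη : Measurable η)
    (h : ∀ x, η (T x) = η x) : MeasurePreserving T (ν.withDensity η) (ν.withDensity η) := by
  refine ⟨hT.measurable, Measure.ext fun s hs => ?_⟩
  rw [Measure.map_apply hT.measurable hs, withDensity_apply _ (hT.measurable hs),
    withDensity_apply _ hs, ← hT.setLIntegral_comp_preimage hs hη]
  simp_rw [h]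

theorem norm_circleMap_zero_one (θ : ℝ) : ‖circleMap 0 1 θ‖ = 1 := by simp

/-- The Fourier coefficient of order `N` of an entire function over the circle of radius `r` is
proportional to `r ^ N`. -/
theorem integral_circle_pow_eq {φ : ℂ → ℂ} (hφ : Differentiable ℂ φ) (N : ℕ) {r : ℝ} (hr : 0 < r) :
    ∫ θ in (0)..2 * Real.pi, φ (r * circleMap 0 1 θ) * conj (circleMap 0 1 θ) ^ N =
      r ^ N * ∫ θ in (0)..2 * Real.pi, φ (circleMap 0 1 θ) * conj (circleMap 0 1 θ) ^ N := by
  have hcoef : ∀ r : ℝ, 0 < r → ∮ ζ in C(0, r), (ζ ^ (N + 1))⁻¹ * φ ζ =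
      Complex.I * ((r : ℂ) ^ N)⁻¹ *
        ∫ θ in (0)..2 * Real.pi, φ (r * circleMap 0 1 θ) * conj (circleMap 0 1 θ) ^ N := by
    intro r hr
    rw [circleIntegral, ← intervalIntegral.integral_const_mul]
    congr 1; ext θ
    have hr' : (r : ℂ) ≠ 0 := by exact_mod_cast hr.ne'
    have hu : circleMap 0 1 θ ≠ 0 := circleMap_ne_center one_ne_zero
    have hconj : conj (circleMap 0 1 θ) = (circleMap 0 1 θ)⁻¹ := by
      rw [Complex.inv_def, Complex.normSq_eq_norm_sq]; simp
    have hm : circleMap 0 r θ = r * circleMap 0 1 θ := by simp [circleMap]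
    rw [deriv_circleMap, hm, hconj, smul_eq_mul, mul_pow, pow_succ, pow_succ, inv_pow]
    field_simp
  have hmono : ∀ r s : ℝ, 0 < r → r ≤ s →
      ∮ ζ in C(0, s), (ζ ^ (N + 1))⁻¹ * φ ζ = ∮ ζ in C(0, r), (ζ ^ (N + 1))⁻¹ * φ ζ := by
    intro r s hr hrs
    have hd : ∀ ζ : ℂ, ζ ≠ 0 → DifferentiableAt ℂ (fun ζ => (ζ ^ (N + 1))⁻¹ * φ ζ) ζ :=
      fun ζ hζ => ((differentiableAt_id.pow _).inv (pow_ne_zero _ hζ)).mul hφ.differentiableAt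
    refine Complex.circleIntegral_eq_of_differentiable_on_annulus_off_countable hr hrs
      countable_empty (fun ζ hζ => ?_) (fun ζ hζ => ?_)
    · refine (hd ζ ?_).continuousAt.continuousWithinAt
      rintro rfl; exact hζ.2 (Metric.mem_ball_self hr)
    · refine hd ζ ?_
      rintro rfl; exact hζ.1.2 (Metric.mem_closedBall_self hr.le)
  have heq : ∮ ζ in C(0, r), (ζ ^ (N + 1))⁻¹ * φ ζ = ∮ ζ in C(0, 1), (ζ ^ (N + 1))⁻¹ * φ ζ := by
    rcases le_total r 1 with h | h
    · exact (hmono r 1 hr h).symm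
    · exact hmono 1 r one_pos h
  rw [hcoef r hr, hcoef 1 one_pos] at heq
  have hr' : (r : ℂ) ≠ 0 := by exact_mod_cast hr.ne'
  simp only [Complex.ofReal_one, one_pow, inv_one, mul_one, one_mul] at heq
  field_simp at heq
  exact heq

/-- For entire `H`, the integral of `H` against `conj z_i ^ N exp (-b ‖z‖²)` depends on `b` only
through a power of `b`: only the homogeneous part of degree `N` of `H` contributes. -/
theorem integral_mul_conj_monomialGaussian {n : ℕ} (i : Fin n) (N : ℕ) {H : (Fin n → ℂ) → ℂ}
    (hH : Differentiable ℂ H) {a b : ℝ} (ha : 0 < a) (hb : 0 < b)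
    (hia : Integrable fun z => H z * conj (monomialGaussian i N a z))
    (hib : Integrable fun z => H z * conj (monomialGaussian i N b z)) :
    ∫ z, H z * conj (monomialGaussian i N b z) =
      ((a / b) ^ (N + n) : ℝ) * ∫ z, H z * conj (monomialGaussian i N a z) := by
  -- `HN` is `2π` times the homogeneous part of degree `N` of `H`.
  set HN : (Fin n → ℂ) → ℂ := fun z =>
    ∫ θ in (0)..2 * Real.pi, H (circleMap 0 1 θ • z) * conj (circleMap 0 1 θ) ^ N with hHN
  have hhom : ∀ (t : ℝ), 0 < t → ∀ z, HN (t • z) = t ^ N * HN z := by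
    intro t ht z
    have h := integral_circle_pow_eq (φ := fun ζ => H (ζ • z))
      (hH.comp (differentiable_id.smul_const z)) N ht
    simp only [hHN]
    rw [← h]
    congr 1; ext θ
    congr 2
    ext j; simp; ring
  -- Averaging over the rotations `z ↦ exp (iθ) z` replaces `H` by that part.
  have hav : ∀ b : ℝ, Integrable (fun z => H z * conj (monomialGaussian i N b z)) →
      2 * Real.pi * ∫ z, H z * conj (monomialGaussian i N b z) =
        ∫ z, HN z * conj (monomialGaussian i N b z) := by
    intro b hib
    have hcm : Continuous fun p : ℝ × (Fin n → ℂ) => circleMap 0 1 p.1 • p.2 := by fun_prop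
    rw [(integral_eq_integral_average (R := fun θ z => circleMap 0 1 θ • z) (fun θ => by
      simpa [circleMap] using measurePreserving_unit_smul (k := n) (Circle.exp θ))
      hcm.measurable hib).2]
    congr 1; ext z
    simp only [hHN]
    rw [← intervalIntegral.integral_mul_const]
    congr 1; ext θ
    simp only [monomialGaussian, normSq_complex_smul, norm_circleMap_zero_one, Pi.smul_apply,
      smul_eq_mul, map_mul, map_pow, mul_pow, one_pow, one_mul]
    ring
  have hab : 0 < a / b := div_pos ha hb
  have ht : 0 < √(a / b) := Real.sqrt_pos.2 hab
  have hsq : (√(a / b)) ^ 2 = a / b := Real.sq_sqrt hab.le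
  have hscale := Measure.integral_comp_smul (volume : Measure (Fin n → ℂ))
    (fun z => HN z * conj (monomialGaussian i N b z)) (√(a / b))
  have hpt : ∀ z, HN (√(a / b) • z) * conj (monomialGaussian i N b (√(a / b) • z)) =
      ((a / b) ^ N : ℝ) * (HN z * conj (monomialGaussian i N a z)) := by
    intro z
    rw [hhom _ ht, monomialGaussian, monomialGaussian, normSq_real_smul, hsq,
      show -b * (a / b * normSq z) = -a * normSq z by field_simp,
      show (a / b) ^ N = √(a / b) ^ N * √(a / b) ^ N by rw [← mul_pow, ← sq, hsq]]
    simp only [Pi.smul_apply, Complex.real_smul, map_mul, map_pow, Complex.conj_ofReal]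
    push_cast
    ring
  simp_rw [hpt] at hscale
  rw [integral_const_mul, finrank_real_fin_complex, pow_mul, hsq, abs_of_pos (by positivity),
    ← hav b hib, ← hav a hia, Complex.real_smul] at hscale
  have hpi : (Real.pi : ℂ) ≠ 0 := by exact_mod_cast Real.pi_ne_zero
  have habc : (((a / b) ^ n : ℝ) : ℂ) ≠ 0 := by exact_mod_cast (pow_pos hab n).ne'
  rw [pow_add, Complex.ofReal_mul]
  rw [Complex.ofReal_inv] at hscale
  field_simp at hscale
  linear_combination -hscale

/-! ### Pairing holomorphic functions on the domain with functions of `z` -/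

theorem weightedMeasure_eq_withDensity_indicator (n m : ℕ) (μ : ℝ)
    (η : (Fin n → ℂ) × (Fin m → ℂ) → ℝ) : weightedMeasure (domain n m μ) η =
      volume.withDensity ((domain n m μ).indicator fun x => ENNReal.ofReal (η x)) :=
  (withDensity_indicator (isOpen_domain n m μ).measurableSet _).symm

theorem sFinite_weightedMeasure (n m : ℕ) (μ α : ℝ) :
    SFinite (weightedMeasure (domain n m μ) (weight n m μ α)) := by
  unfold weightedMeasure; infer_instance

theorem measurePreserving_rotate_snd (n m : ℕ) (μ α : ℝ) (c : Circle) :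
    MeasurePreserving (fun x : (Fin n → ℂ) × (Fin m → ℂ) => (x.1, (c : ℂ) • x.2))
      (weightedMeasure (domain n m μ) (weight n m μ α))
      (weightedMeasure (domain n m μ) (weight n m μ α)) := by
  rw [weightedMeasure_eq_withDensity_indicator]
  refine MeasurePreserving.withDensity_of_comp_eq
    ((MeasurePreserving.id volume).prod (measurePreserving_unit_smul c)) ?_ fun x => ?_
  · exact (measurable_weight n m μ α).ennreal_ofReal.indicator
      (isOpen_domain n m μ).measurableSet
  · have hc : ‖(c : ℂ)‖ = 1 := Circle.norm_coe c
    simp [indicator, domain, weight, rho, normSq_complex_smul, hc]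

/-- Integrated against a function of `z` alone, a holomorphic function on the domain may be
replaced by its restriction to `w = 0`: this is the mean value property on the circles
`w ↦ exp (iθ) w`, along which both the domain and the weight are invariant. -/
theorem integral_mul_fst_eq {n m : ℕ} {μ α : ℝ} {h : (Fin n → ℂ) × (Fin m → ℂ) → ℂ}
    (hh : DifferentiableOn ℂ h (domain n m μ)) {G : (Fin n → ℂ) → ℂ}
    (hi : Integrable (fun x => h x * G x.1) (weightedMeasure (domain n m μ) (weight n m μ α))) :
    Integrable (fun x : (Fin n → ℂ) × (Fin m → ℂ) => h (x.1, 0) * G x.1)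
        (weightedMeasure (domain n m μ) (weight n m μ α)) ∧
      ∫ x, h x * G x.1 ∂weightedMeasure (domain n m μ) (weight n m μ α) =
        ∫ x, h (x.1, 0) * G x.1 ∂weightedMeasure (domain n m μ) (weight n m μ α) := by
  have := sFinite_weightedMeasure n m μ α
  have hcm : Continuous fun p : ℝ × ((Fin n → ℂ) × (Fin m → ℂ)) =>
      (p.2.1, circleMap 0 1 p.1 • p.2.2) := by fun_prop
  obtain ⟨h1, h2⟩ := integral_eq_integral_average
    (R := fun θ (x : (Fin n → ℂ) × (Fin m → ℂ)) => (x.1, circleMap 0 1 θ • x.2)) (fun θ => by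
      simpa [circleMap] using measurePreserving_rotate_snd n m μ α (Circle.exp θ))
    hcm.measurable hi
  have hmem : ∀ᵐ x ∂weightedMeasure (domain n m μ) (weight n m μ α), x ∈ domain n m μ :=
    (withDensity_absolutelyContinuous _ _).ae_le
      (ae_restrict_mem (isOpen_domain n m μ).measurableSet)
  have hmean : ∀ x ∈ domain n m μ, ∫ θ in (0)..2 * Real.pi,
      h (x.1, circleMap 0 1 θ • x.2) * G x.1 = 2 * Real.pi * (h (x.1, 0) * G x.1) := by
    rintro ⟨z, w⟩ hx
    have hd : DiffContOnCl ℂ (fun t : ℂ => h (z, t • w)) (Metric.ball 0 |1|) := by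
      apply DifferentiableOn.diffContOnCl
      apply hh.comp (by fun_prop)
      intro t ht
      have ht' : ‖t‖ ≤ 1 := by simpa [closure_ball] using ht
      have hx : normSq w < Real.exp (-μ * normSq z) := hx
      refine lt_of_le_of_lt ?_ hx
      rw [normSq_complex_smul]
      exact mul_le_of_le_one_left (normSq_nonneg w) (pow_le_one₀ (norm_nonneg _) ht')
    have hc := hd.circleAverage
    simp only [zero_smul, Real.circleAverage_def, Complex.real_smul] at hc
    rw [intervalIntegral.integral_mul_const, ← hc]
    push_cast
    have hpi : (Real.pi : ℂ) ≠ 0 := by exact_mod_cast Real.pi_ne_zero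
    field_simp
  have hae := hmem.mono hmean
  have hpi : (2 * Real.pi : ℂ) ≠ 0 := by exact_mod_cast (by positivity : 2 * Real.pi ≠ 0)
  refine ⟨((h1.congr hae).const_mul (2 * Real.pi : ℂ)⁻¹).congr (ae_of_all _ fun x => ?_), ?_⟩
  · simp only
    rw [inv_mul_cancel_left₀ hpi]
  · rw [integral_congr_ae hae, integral_const_mul] at h2
    exact mul_left_cancel₀ hpi h2

theorem memLp_comp_fst {n m : ℕ} {μ α : ℝ} (hm : 1 ≤ m) (hα : -1 < α) {q : ℝ≥0∞}
    {G : (Fin n → ℂ) → ℂ} (hG : Continuous G)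
    (h : MemLp G q (gaussianMeasure n (μ * (α + m)))) :
    MemLp (fun x : (Fin n → ℂ) × (Fin m → ℂ) => G x.1) q
      (weightedMeasure (domain n m μ) (weight n m μ α)) := by
  refine (memLp_map_measure_iff (f := Prod.fst) hG.aestronglyMeasurable
    measurable_fst.aemeasurable).1 ?_
  rw [map_fst_weightedMeasure]
  exact h.smul_measure (fiberMass_ne_top hm hα)

theorem eLpNorm_monomialGaussian_fst {n m : ℕ} {μ α : ℝ} (i : Fin n) (N : ℕ) (c : ℝ) {q : ℝ}
    (hq : 0 < q) :
    eLpNorm (fun x : (Fin n → ℂ) × (Fin m → ℂ) => monomialGaussian i N c x.1) (ENNReal.ofReal q)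
        (weightedMeasure (domain n m μ) (weight n m μ α)) =
      fiberMass m α ^ (1 / q) * gaussianMoment i (N * q) (μ * (α + m) + q * c) ^ (1 / q) := by
  have h := eLpNorm_map_measure (p := ENNReal.ofReal q) (f := Prod.fst)
    (μ := weightedMeasure (domain n m μ) (weight n m μ α))
    (continuous_monomialGaussian i N c).aestronglyMeasurable measurable_fst.aemeasurable
  rw [map_fst_weightedMeasure, eLpNorm_smul_measure_of_ne_top ENNReal.ofReal_ne_top,
    eLpNorm_monomialGaussian i N c _ hq, smul_eq_mul] at h
  rw [show (fun x : (Fin n → ℂ) × (Fin m → ℂ) => monomialGaussian i N c x.1) =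
    monomialGaussian i N c ∘ Prod.fst from rfl, ← h]
  congr 2
  simp [ENNReal.toReal_ofReal hq.le]

theorem monomialGaussian_mul_exp {n : ℕ} (i : Fin n) (N : ℕ) (a c : ℝ) (z : Fin n → ℂ) :
    (Real.exp (-a * normSq z) : ℂ) * conj (monomialGaussian i N c z) =
      conj (monomialGaussian i N (a + c) z) := by
  simp only [monomialGaussian, map_mul, Complex.conj_ofReal]
  rw [mul_left_comm, ← Complex.ofReal_mul, ← Real.exp_add]
  ring_nf

theorem mem_domain_zero (n m : ℕ) (μ : ℝ) (z : Fin n → ℂ) :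
    (z, (0 : Fin m → ℂ)) ∈ domain n m μ := by
  simpa [domain, normSq] using Real.exp_pos _

theorem differentiable_restrict_zero {n m : ℕ} {μ : ℝ} {h : (Fin n → ℂ) × (Fin m → ℂ) → ℂ}
    (hh : DifferentiableOn ℂ h (domain n m μ)) :
    Differentiable ℂ fun z : Fin n → ℂ => h (z, (0 : Fin m → ℂ)) := fun z =>
    (hh.differentiableAt ((isOpen_domain n m μ).mem_nhds (mem_domain_zero n m μ z))).comp z
      (f := fun z => (z, (0 : Fin m → ℂ))) (by fun_prop)

/-- The pairing of a holomorphic function with `z_i^N exp (-c ‖z‖²)`, as an integral over `ℂ^n`. -/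
theorem integral_mul_conj_monomialGaussian_fst {n m : ℕ} {μ α : ℝ} (hm : 1 ≤ m) (hα : -1 < α)
    {h : (Fin n → ℂ) × (Fin m → ℂ) → ℂ} (hh : DifferentiableOn ℂ h (domain n m μ))
    (hL : MemLp h 2 (weightedMeasure (domain n m μ) (weight n m μ α))) (i : Fin n) (N : ℕ) {c : ℝ}
    (hc : 0 < μ * (α + m) + 2 * c) :
    Integrable (fun z => h (z, 0) * conj (monomialGaussian i N (μ * (α + m) + c) z)) ∧
      ∫ x, h x * conj (monomialGaussian i N c x.1)
          ∂weightedMeasure (domain n m μ) (weight n m μ α) =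
        (fiberMass m α).toReal *
          ∫ z, h (z, 0) * conj (monomialGaussian i N (μ * (α + m) + c) z) := by
  set a := μ * (α + m) with ha
  have hG2 : MemLp (fun x : (Fin n → ℂ) × (Fin m → ℂ) => conj (monomialGaussian i N c x.1)) 2
      (weightedMeasure (domain n m μ) (weight n m μ α)) := by
    have h2 := memLp_monomialGaussian i N (c := c) (b := a) two_pos hc
    rw [ENNReal.ofReal_ofNat] at h2
    exact (memLp_comp_fst hm hα (continuous_monomialGaussian i N c) h2).star
  have hi := hL.integrable_mul hG2
  obtain ⟨h1, h2⟩ := integral_mul_fst_eq (G := fun z => conj (monomialGaussian i N c z)) hh hi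
  have hHd := differentiable_restrict_zero hh
  have hcont : Continuous fun z : Fin n → ℂ => h (z, 0) * conj (monomialGaussian i N c z) :=
    hHd.continuous.mul (Complex.continuous_conj.comp (continuous_monomialGaussian i N c))
  have hmap := integral_map (μ := weightedMeasure (domain n m μ) (weight n m μ α))
    measurable_fst.aemeasurable hcont.aestronglyMeasurable
  have hmapi := (integrable_map_measure (μ := weightedMeasure (domain n m μ) (weight n m μ α))
    hcont.aestronglyMeasurable measurable_fst.aemeasurable).2 h1
  rw [map_fst_weightedMeasure] at hmap hmapi
  have hmapi := (integrable_smul_measure (fiberMass_ne_zero m α) (fiberMass_ne_top hm hα)).1 hmapi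
  have hpt : ∀ z : Fin n → ℂ, (ENNReal.ofReal (Real.exp (-a * normSq z))).toReal •
      (h (z, 0) * conj (monomialGaussian i N c z)) =
        h (z, 0) * conj (monomialGaussian i N (a + c) z) := by
    intro z
    rw [ENNReal.toReal_ofReal (Real.exp_pos _).le, Complex.real_smul, mul_left_comm,
      monomialGaussian_mul_exp]
  rw [gaussianMeasure, integrable_withDensity_iff_integrable_smul' (measurable_gaussian n _)
    (ae_of_all _ fun _ => ENNReal.ofReal_lt_top)] at hmapi
  rw [integral_smul_measure, gaussianMeasure, integral_withDensity_eq_integral_toReal_smul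
    (measurable_gaussian n _) (ae_of_all _ fun _ => ENNReal.ofReal_lt_top)] at hmap
  simp_rw [← ha, hpt] at hmap hmapi
  refine ⟨hmapi, ?_⟩
  rw [h2, ← hmap, Complex.real_smul]

/-- The projection maps `z_i^N exp (-c ‖z‖²)` to a multiple of `z_i^N`. -/
theorem projection_monomialGaussian {n m : ℕ} {μ α : ℝ} (hm : 1 ≤ m) (hμ : 0 < μ) (hα : -1 < α)
    (i : Fin n) (N : ℕ) {c : ℝ} (hc : 0 < μ * (α + m) + 2 * c)
    (hf : MemLp (fun x : (Fin n → ℂ) × (Fin m → ℂ) => monomialGaussian i N c x.1) 2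
      (weightedMeasure (domain n m μ) (weight n m μ α))) :
    projection n m μ α hf.toLp =ᵐ[weightedMeasure (domain n m μ) (weight n m μ α)]
      fun x => (((μ * (α + m)) / (μ * (α + m) + c)) ^ (N + n) : ℝ) •
        monomialGaussian i N 0 x.1 := by
  have hm' : (1 : ℝ) ≤ m := by exact_mod_cast hm
  have ha : 0 < μ * (α + m) := mul_pos hμ (by linarith)
  set a := μ * (α + m) with ha_def
  have hac : 0 < a + c := by linarith
  set s : ℝ := (a / (a + c)) ^ (N + n) with hs
  have hg : MemLp (fun x : (Fin n → ℂ) × (Fin m → ℂ) => monomialGaussian i N 0 x.1) 2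
      (weightedMeasure (domain n m μ) (weight n m μ α)) := by
    have h2 := memLp_monomialGaussian i N (c := 0) (b := a) two_pos (by linarith)
    rw [ENNReal.ofReal_ofNat] at h2
    exact memLp_comp_fst hm hα (continuous_monomialGaussian i N 0) h2
  have key : projection n m μ α hf.toLp = (s : ℂ) • hg.toLp := by
    have : CompleteSpace (weightedBergmanSpace (domain n m μ) (weight n m μ α)) :=
      (isClosed_weightedBergmanSpace (isOpen_domain n m μ) (continuousOn_weight n m μ α)
        (weight_pos n m μ α)).completeSpace_coe
    refine Submodule.eq_starProjection_of_mem_of_inner_eq_zero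
      (Submodule.smul_mem _ _ ⟨_, ?_, hg.coeFn_toLp⟩) ?_
    · simp only [monomialGaussian, neg_zero, zero_mul, Real.exp_zero]
      fun_prop
    · rintro w ⟨h, hh, hwh⟩
      have hL : MemLp h 2 (weightedMeasure (domain n m μ) (weight n m μ α)) :=
        (memLp_congr_ae hwh).1 (Lp.memLp w)
      have hinner : ∀ (d : ℝ) (hd : MemLp (fun x : (Fin n → ℂ) × (Fin m → ℂ) =>
          monomialGaussian i N d x.1) 2 (weightedMeasure (domain n m μ) (weight n m μ α))),
          inner ℂ hd.toLp w = ∫ x, h x * conj (monomialGaussian i N d x.1)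
            ∂weightedMeasure (domain n m μ) (weight n m μ α) := by
        intro d hd
        rw [L2.inner_def]
        refine integral_congr_ae ?_
        filter_upwards [hd.coeFn_toLp, hwh] with x h1 h2
        rw [h1, h2, RCLike.inner_apply]
      obtain ⟨i1, e1⟩ := integral_mul_conj_monomialGaussian_fst hm hα hh hL i N hc
      obtain ⟨i0, e0⟩ := integral_mul_conj_monomialGaussian_fst hm hα hh hL i N (c := 0)
        (by linarith)
      rw [← ha_def, add_zero] at i0 e0
      rw [← ha_def] at i1 e1
      rw [inner_sub_left, inner_smul_left, hinner, hinner, e1, e0, Complex.conj_ofReal,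
        integral_mul_conj_monomialGaussian i N (differentiable_restrict_zero hh) ha hac i0 i1]
      ring
  rw [key]
  filter_upwards [Lp.coeFn_smul (s : ℂ) hg.toLp, hg.coeFn_toLp] with x h1 h2
  rw [h1, Pi.smul_apply, h2, Complex.real_smul, smul_eq_mul]

/-! ### Boundedness on `L^p` -/

theorem isLpBounded_projection_two (n m : ℕ) (μ α : ℝ) : IsLpBounded (projection n m μ α) 2 := by
  refine ⟨1, fun f _ => ?_⟩
  rw [ENNReal.ofReal_ofNat]
  refine ⟨Lp.memLp _, ?_⟩
  have : CompleteSpace (weightedBergmanSpace (domain n m μ) (weight n m μ α)) :=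
    (isClosed_weightedBergmanSpace (isOpen_domain n m μ) (continuousOn_weight n m μ α)
      (weight_pos n m μ α)).completeSpace_coe
  have h : ‖projection n m μ α f‖ ≤ ‖f‖ :=
    Submodule.norm_starProjection_apply_le (weightedBergmanSpace (domain n m μ) (weight n m μ α)) f
  rw [ENNReal.coe_one, one_mul, ← Lp.enorm_def, ← Lp.enorm_def]
  exact enorm_le_iff_norm_le.2 h

/-- The necessary condition for boundedness on `L^p` that the test functions
`z_i^N exp (-c ‖z‖²)` give: both sides are norms relative to the `L^p` norm of `z_i^N`. -/
theorem ratio_pow_le_of_isLpBounded {n m : ℕ} {μ α p c : ℝ} (hm : 1 ≤ m) (hμ : 0 < μ)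
    (hα : -1 < α) (hp : 0 < p) (hb : IsLpBounded (projection n m μ α) p) (i : Fin n)
    (hc2 : 0 < μ * (α + m) + 2 * c) (hcp : 0 < μ * (α + m) + p * c) :
    ∃ C : ℝ, ∀ N : ℕ, (μ * (α + m) / (μ * (α + m) + c)) ^ (N + n) ≤
      C * ((μ * (α + m) / (μ * (α + m) + p * c)) ^ (N * p / 2 + n)) ^ (1 / p) := by
  obtain ⟨C, hC⟩ := hb
  refine ⟨C, fun N => ?_⟩
  have hm' : (1 : ℝ) ≤ m := by exact_mod_cast hm
  have ha : 0 < μ * (α + m) := mul_pos hμ (by linarith)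
  set a := μ * (α + m) with ha_def
  have hac : 0 < a + c := by linarith
  have hf2 : MemLp (fun x : (Fin n → ℂ) × (Fin m → ℂ) => monomialGaussian i N c x.1) 2
      (weightedMeasure (domain n m μ) (weight n m μ α)) := by
    have h2 := memLp_monomialGaussian i N (c := c) (b := a) two_pos hc2
    rw [ENNReal.ofReal_ofNat] at h2
    exact memLp_comp_fst hm hα (continuous_monomialGaussian i N c) h2
  have hfp := memLp_comp_fst hm hα (continuous_monomialGaussian i N c)
    (memLp_monomialGaussian i N (c := c) (b := a) hp hcp)
  have h := (hC hf2.toLp ((memLp_congr_ae hf2.coeFn_toLp).2 hfp)).2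
  rw [eLpNorm_congr_ae hf2.coeFn_toLp,
    eLpNorm_congr_ae (projection_monomialGaussian hm hμ hα i N hc2 hf2)] at h
  have hs := eLpNorm_const_smul ((a / (a + c)) ^ (N + n) : ℝ)
    (fun x : (Fin n → ℂ) × (Fin m → ℂ) => monomialGaussian i N 0 x.1) (ENNReal.ofReal p)
    (weightedMeasure (domain n m μ) (weight n m μ α))
  have h := hs.symm.trans_le h
  rw [eLpNorm_monomialGaussian_fst i N 0 hp, eLpNorm_monomialGaussian_fst i N c hp, mul_zero,
    add_zero, ← ha_def, gaussianMoment_eq_mul i _ ha hcp,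
    ENNReal.mul_rpow_of_nonneg _ _ (by positivity : (0 : ℝ) ≤ 1 / p)] at h
  set V := fiberMass m α ^ (1 / p) * gaussianMoment i (N * p) a ^ (1 / p) with hV
  have hV0 : V ≠ 0 := mul_ne_zero
    (ENNReal.rpow_pos (pos_iff_ne_zero.2 (fiberMass_ne_zero m α)) (fiberMass_ne_top hm hα)).ne'
    (ENNReal.rpow_pos (pos_iff_ne_zero.2 (gaussianMoment_ne_zero i _ _))
      (gaussianMoment_ne_top i (by positivity) ha)).ne'
  have hVt : V ≠ ∞ := ENNReal.mul_ne_top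
    (ENNReal.rpow_ne_top_of_nonneg (by positivity) (fiberMass_ne_top hm hα))
    (ENNReal.rpow_ne_top_of_nonneg (by positivity) (gaussianMoment_ne_top i (by positivity) ha))
  rw [mul_left_comm (fiberMass m α ^ (1 / p)), ← hV, ← mul_assoc (C : ℝ≥0∞),
    ENNReal.mul_le_mul_iff_left hV0 hVt,
    ENNReal.ofReal_rpow_of_nonneg (by positivity) (by positivity),
    Real.enorm_of_nonneg (by positivity), ← ENNReal.ofReal_coe_nnreal,
    ← ENNReal.ofReal_mul C.coe_nonneg] at h
  exact (ENNReal.ofReal_le_ofReal_iff (by positivity)).1 h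

theorem eq_two_of_isLpBounded_projection {n m : ℕ} (hn : 1 ≤ n) (hm : 1 ≤ m) {μ α p : ℝ}
    (hμ : 0 < μ) (hα : -1 < α) (hp : 1 ≤ p) (hb : IsLpBounded (projection n m μ α) p) :
    p = 2 := by
  by_contra hne
  -- With `a = μ (α + m)` and `s = a / (a + c)`, `t = a / (a + p c)`, boundedness forces
  -- `(s / √t) ^ N` to stay bounded; a suitable `c` with the sign of `p - 2` makes `s ^ 2 > t`.
  have hm' : (1 : ℝ) ≤ m := by exact_mod_cast hm
  have ha : 0 < μ * (α + m) := mul_pos hμ (by linarith)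
  have hp0 : 0 < p := by linarith
  have hsq : 0 < (p - 2) ^ 2 := by have := sub_ne_zero.2 hne; positivity
  -- `(a + c) ^ 2 < a * (a + p * c)` amounts to `c ^ 2 < (p - 2) * a * c`.
  obtain ⟨c, hc2, hcp, hlt⟩ : ∃ c : ℝ, 0 < μ * (α + m) + 2 * c ∧ 0 < μ * (α + m) + p * c ∧
      (μ * (α + m) + c) ^ 2 < μ * (α + m) * (μ * (α + m) + p * c) := by
    -- The factor `1 / 4`, rather than `1 / 2`, keeps `a + 2 * c` positive also for `p = 1`.
    refine ⟨(p - 2) * (μ * (α + m)) / 4, ?_, ?_, ?_⟩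
    · nlinarith [mul_pos ha hp0]
    · nlinarith [mul_nonneg ha.le (sq_nonneg (p - 1))]
    · nlinarith [mul_pos (mul_pos ha ha) hsq]
  obtain ⟨C, hC⟩ := ratio_pow_le_of_isLpBounded hm hμ hα hp0 hb ⟨0, hn⟩ hc2 hcp
  set a := μ * (α + m)
  have hac : 0 < a + c := by linarith
  set s := a / (a + c)
  set t := a / (a + p * c)
  have hs : 0 < s := div_pos ha hac
  have ht : 0 < t := div_pos ha hcp
  have hst : t < s ^ 2 := by
    rw [div_pow, div_lt_div_iff₀ hcp (by positivity)]
    nlinarith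
  have hst' : 1 < s / √t := by
    rw [one_lt_div (Real.sqrt_pos.2 ht)]
    exact (Real.sqrt_lt' hs).2 hst
  have hbound : ∀ N : ℕ, (s / √t) ^ N ≤ C * (t ^ n) ^ (1 / p) / s ^ n := by
    intro N
    have h := hC N
    have e : (t ^ (N * p / 2 + n)) ^ (1 / p) = √t ^ N * (t ^ n) ^ (1 / p) := by
      rw [Real.rpow_add ht, Real.rpow_natCast, Real.mul_rpow (by positivity) (by positivity),
        ← Real.rpow_mul ht.le, Real.sqrt_eq_rpow, ← Real.rpow_natCast (t ^ (1 / 2 : ℝ)),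
        ← Real.rpow_mul ht.le]
      congr 2
      field_simp
    rw [e, pow_add] at h
    rw [div_pow, le_div_iff₀ (by positivity), div_mul_eq_mul_div, div_le_iff₀ (by positivity)]
    linarith
  obtain ⟨N, hN⟩ := pow_unbounded_of_one_lt (C * (t ^ n) ^ (1 / p) / s ^ n) hst'
  exact absurd (hbound N) (not_le.2 hN)

theorem isLpBounded_projection_iff {n m : ℕ} (hn : 1 ≤ n) (hm : 1 ≤ m) {μ α p : ℝ}
    (hμ : 0 < μ) (hα : -1 < α) (hp : 1 ≤ p) : IsLpBounded (projection n m μ α) p ↔ p = 2 :=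
  ⟨eq_two_of_isLpBounded_projection hn hm hμ hα hp, fun h => h ▸ isLpBounded_projection_two n m μ α⟩

theorem isLpBounded_weightedBergmanProjection_congr {n m : ℕ} {μ p : ℝ}
    {η η' : (Fin n → ℂ) × (Fin m → ℂ) → ℝ} (h : η = η') (hη : ContinuousOn η (domain n m μ))
    (hpos : ∀ x ∈ domain n m μ, 0 < η x) (hη' : ContinuousOn η' (domain n m μ))
    (hpos' : ∀ x ∈ domain n m μ, 0 < η' x) :
    IsLpBounded (weightedBergmanProjection (domain n m μ) η (isOpen_domain n m μ) hη hpos) p ↔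
      IsLpBounded (weightedBergmanProjection (domain n m μ) η' (isOpen_domain n m μ) hη' hpos')
        p := by
  subst h; rfl

theorem weight_zero (n m : ℕ) (μ : ℝ) : weight n m μ 0 = fun _ => 1 :=
  funext fun _ => Real.rpow_zero _

end FockBargmannHartogs

theorem theorem1p2 (n m : ℕ) (hn : 1 ≤ n) (hm : 1 ≤ m) (μ α p : ℝ) (hμ : 0 < μ) (hα : -1 < α)
    (hp : 1 ≤ p) :
    (FockBargmannHartogs.IsLpBounded (FockBargmannHartogs.projection n m μ α) p ↔ p = 2) ∧
      (FockBargmannHartogs.IsLpBounded (FockBargmannHartogs.ordinaryProjection n m μ) p ↔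
        p = 2) := by
  refine ⟨FockBargmannHartogs.isLpBounded_projection_iff hn hm hμ hα hp, ?_⟩
  rw [← FockBargmannHartogs.isLpBounded_projection_iff hn hm hμ (neg_one_lt_zero : (-1 : ℝ) < 0) hp]
  exact FockBargmannHartogs.isLpBounded_weightedBergmanProjection_congr
    (FockBargmannHartogs.weight_zero n m μ).symm _ _ _ _
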